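/- Let $q$ be a prime power, let $X\subseteq\mathbb P^2$ be the Hermitian curve $y^qz+yz^q=x^{q+1}$ over $\mathbb F_{q^2}$, let $P_\infty=(0:1:0)$ and $B=X(\mathbb F_{q^2})\setminus\{P_\infty\}$. For integers $d,a>0$ let $C(d,a)\subseteq\mathbb F_{q^2}^{B}$ be the code obtained by evaluating at the points $(x:y:1)$ of $B$ the vector space $H^0(X,\mathcal O_X(d)(-aP_\infty))$ of the homogeneous forms of degree $d$ on $X$ that vanish on the scheme $aP_\infty$. For a subset $H\subseteq B$ let $C(d,a,H)\subseteq\mathbb F_{q^2}^{B\setminus H}$ be the code obtained by evaluating the same space on $B\setminus H$ only; equivalently, the projection $\pi_H(C(d,a))$ that deletes the coordinates in $H$. A non-empty subset $H\subseteq B$ is called an improving subset for $C(d,a)^\perp$ if the minimum distance of $\pi_H(C(d,a))^\perp$ is strictly greater than the minimum distance of $C(d,a)^\perp$, where the minimum distance of the zero code is $\infty$. Let $0<d<q$ and $1\le a\le d$ be integers. A non-empty subset $H\subseteq B$ is an improving subset for $C(d,a)^\perp$ if and only if there are no $d+1$ distinct points of $B\setminus H$ lying on a common line of $\mathbb P^2$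 through $P_\infty$. In particular, if $H$ is an improving subset for $C(d,a)^\perp$, then $\sharp H\ge q^2(q-d)$, and so the length of $C(d,a,H)^\perp$ is at most $q^2d$. -/

import Mathlib

open scoped LinearAlgebra.Projectivization

noncomputable section

/-! ### Linear codes -/

namespace LinCode

variable {K ι : Type*} [Field K]

/-- The length of a code `C ⊆ K^ι`: the number of coordinates. -/
def length (_C : Submodule K (ι → K)) : ℕ := Nat.card ι

open Classical in
/-- The minimum distance of a code: the least Hamming distance between two distinct codewords.
It takes values in `ℕ∞`, and the minimum distance of the zero code is `∞`. -/
def minDist [Fintype ι] (C : Submodule K (ι → K)) : ℕ∞ :=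
  ⨅ v ∈ C, ⨅ w ∈ C, ⨅ (_ : v ≠ w), (hammingDist v w : ℕ∞)

/-- The dual code `C^⊥`, with respect to the product `v · w = ∑ v_i w_i`. -/
def dual [Fintype ι] (C : Submodule K (ι → K)) : Submodule K (ι → K) where
  carrier := {v | ∀ c ∈ C, v ⬝ᵥ c = 0}
  add_mem' {v w} hv hw c hc := by rw [add_dotProduct, hv c hc, hw c hc, add_zero]
  zero_mem' c _ := zero_dotProduct c
  smul_mem' r v hv c hc := by rw [smul_dotProduct, hv c hc, smul_zero]

/-- The projection `π_H` deleting the coordinates whose index lies in `H`. -/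
def proj (K : Type*) [Field K] (H : Set ι) : (ι → K) →ₗ[K] ({i // i ∉ H} → K) :=
  LinearMap.funLeft K K Subtype.val

open Classical in
/-- `H` is an improving subset for `C^⊥`: it is a non-empty set of coordinates such that the
minimum distance of `π_H(C)^⊥` is strictly greater than that of `C^⊥`. -/
def IsImprovingSubset [Fintype ι] (C : Submodule K (ι → K)) (H : Set ι) : Prop :=
  H.Nonempty ∧ minDist (dual C) < minDist (dual (C.map (proj K H)))

end LinCode

/-! ### The Hermitian curve and the codes `C(d,a)`, `C(d,a,H)` -/

namespace Hermitian

open MvPolynomial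

/-- Homogeneous equation `y^q z + y z^q - x^(q+1)` of the Hermitian curve `X`; the homogeneous
coordinates `x, y, z` of the plane are indexed by `0, 1, 2`. -/
def curve (K : Type*) [Field K] (q : ℕ) : MvPolynomial (Fin 3) K :=
  X 1 ^ q * X 2 + X 1 * X 2 ^ q - X 0 ^ (q + 1)

/-- The set `X(K)` of `K`-rational points of the Hermitian curve in the projective plane. -/
def points (K : Type*) [Field K] (q : ℕ) : Set (ℙ K (Fin 3 → K)) :=
  {P | eval P.rep (curve K q) = 0}

/-- The point `P_∞ = (0 : 1 : 0)`. -/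
def Pinfty (K : Type*) [Field K] : ℙ K (Fin 3 → K) :=
  Projectivization.mk K ![0, 1, 0] fun h => one_ne_zero (congrFun h 1)

/-- The evaluation set `B = X(K) \ {P_∞}`. -/
def B (K : Type*) [Field K] (q : ℕ) : Set (ℙ K (Fin 3 → K)) := points K q \ {Pinfty K}

instance instFintypeB (K : Type*) [Field K] [Finite K] (q : ℕ) : Fintype (B K q) :=
  Fintype.ofFinite _

/-- Restriction of a form `f(x, y, z)` to the affine chart `y ≠ 0`, i.e. the polynomial
`f(x, 1, z)` in the affine coordinates `x, z`, indexed by `0, 1`. The point `P_∞` is the origin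
of this chart. -/
def chart (K : Type*) [Field K] : MvPolynomial (Fin 3) K →ₐ[K] MvPolynomial (Fin 2) K :=
  aeval ![X 0, 1, X 1]

/-- The ideal, in the chart `y ≠ 0`, of the divisor `aP_∞` of `X` regarded as a closed subscheme
of the plane: the ideal generated by the equation of `X` and by the `a`-th power of the maximal
ideal of `P_∞`. As this ideal is primary to the maximal ideal of `P_∞` (or the unit ideal when
`a = 0`), belonging to it is a condition in the local ring of `X` at `P_∞` only, namely
vanishing to order at least `a`. -/
def idealE (K : Type*) [Field K] (q a : ℕ) : Ideal (MvPolynomial (Fin 2) K) :=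
  Ideal.span {chart K (curve K q)} ⊔ Ideal.span {X 0, X 1} ^ a

/-- Homogeneous forms of degree `d` which, restricted to `X`, vanish on the scheme `E = aP_∞`.
Restricting them to `X` gives all of `H^0(X, O_X(d)(-aP_∞))`. -/
def forms (K : Type*) [Field K] (q d a : ℕ) : Submodule K (MvPolynomial (Fin 3) K) :=
  homogeneousSubmodule (Fin 3) K d ⊓
    ((idealE K q a).restrictScalars K).comap (chart K).toLinearMap

/-- The representative `(x, y, 1)` of a point of the affine chart `z ≠ 0`, which contains `B`. -/
def affineRep {K : Type*} [Field K] (P : ℙ K (Fin 3 → K)) : Fin 3 → K :=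
  fun i => P.rep i / P.rep 2

/-- Evaluation of polynomials at a family of points of the chart `z ≠ 0`. -/
def evalAt {K ι : Type*} [Field K] (pt : ι → ℙ K (Fin 3 → K)) :
    MvPolynomial (Fin 3) K →ₗ[K] (ι → K) :=
  LinearMap.pi fun i => (aeval (affineRep (pt i))).toLinearMap

/-- The code `C(d,a)`, obtained evaluating `H^0(X, O_X(d)(-aP_∞))` on `B`. -/
def code (K : Type*) [Field K] (q d a : ℕ) : Submodule K (B K q → K) :=
  (forms K q d a).map (evalAt fun P : B K q => (P : ℙ K (Fin 3 → K)))

/-- The code `C(d,a,H)`, obtained evaluating `H^0(X, O_X(d)(-aP_∞))` on `B \ H`. -/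
def codeH {K : Type*} [Field K] (q d a : ℕ) (H : Set (B K q)) :
    Submodule K ({P : B K q // P ∉ H} → K) :=
  (forms K q d a).map (evalAt fun P : {P : B K q // P ∉ H} => (P.1 : ℙ K (Fin 3 → K)))

/-- There are `m` distinct points of `B \ H` lying on a common projective line through `P_∞`. -/
def HasCollinear {K : Type*} [Field K] (q m : ℕ) (H : Set (B K q)) : Prop :=
  ∃ L : Submodule K (Fin 3 → K), Module.finrank K L = 2 ∧ Pinfty K ∈ L.projectivization ∧
    ∃ S : Finset (B K q), S.card = m ∧
      ∀ P ∈ S, P ∉ H ∧ (P : ℙ K (Fin 3 → K)) ∈ L.projectivization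

end Hermitian

end

/-! A dual word supported on S is a linear relation among the evaluations at S of the forms in the
space. If S has at most d + 1 points and is not d + 1 points of one vertical line x = c, then any
point of S can be separated from the others by a form in the space, so no relation exists
(`exists_mem_forms_separating`). If S is d + 1 points of a vertical line, a relation does exist:
forms vanishing at P_∞ restrict to that line as polynomials in y of degree below d
(`exists_mem_dual_evalCode`).

Both facts hold for any injective family of points of B, hence for B and for B \ H alike: the dual
distance is at least d + 1, with equality exactly when the family contains d + 1 points on a line
through P_∞. Each vertical line meets B in q ≥ d + 1 points, so the full dual has distance d + 1,
and H improves it exactly when B \ H has no such d + 1 points. Then each of the q² vertical lines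
keeps at most d points, which gives the bounds. -/

namespace LinCode

variable {K ι : Type*} [Field K] [Fintype ι]

open Classical in
theorem le_minDist_iff {C : Submodule K (ι → K)} {n : ℕ∞} :
    n ≤ minDist C ↔ ∀ v ∈ C, v ≠ 0 → n ≤ (hammingNorm v : ℕ∞) := by
  simp only [minDist, le_iInf_iff]
  constructor
  · intro h v hv hv0
    simpa using h v hv 0 C.zero_mem hv0
  · intro h v hv w hw hvw
    rw [hammingDist_eq_hammingNorm]
    refine h _ (C.add_mem (C.neg_mem hv) hw) fun h0 => hvw ?_
    rwa [neg_add_eq_zero] at h0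

open Classical in
theorem minDist_le_hammingNorm {C : Submodule K (ι → K)} {v : ι → K} (hv : v ∈ C) (h0 : v ≠ 0) :
    minDist C ≤ (hammingNorm v : ℕ∞) :=
  le_minDist_iff.1 le_rfl v hv h0

end LinCode

namespace Hermitian

open MvPolynomial

/-! ### Affine coordinates on B, and lines through P_∞ -/

section Points

variable {K : Type*} [Field K] {q : ℕ}

theorem eval_curve (v : Fin 3 → K) :
    eval v (curve K q) = v 1 ^ q * v 2 + v 1 * v 2 ^ q - v 0 ^ (q + 1) := by
  simp [curve]

theorem rep_two_ne_zero (hq : q ≠ 0) (P : B K q) : (P : ℙ K (Fin 3 → K)).rep 2 ≠ 0 := by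
  obtain ⟨P, hP, hP'⟩ := P
  intro h2
  simp only at h2
  have h0 : P.rep 0 = 0 := by
    have h : eval P.rep (curve K q) = 0 := hP
    rw [eval_curve, h2] at h
    simpa [hq] using h
  apply hP'
  rw [Set.mem_singleton_iff, ← P.mk_rep, Pinfty, Projectivization.mk_eq_mk_iff']
  refine ⟨P.rep 1, ?_⟩
  funext i
  fin_cases i <;> simp [h0, h2]

theorem affineRep_two (hq : q ≠ 0) (P : B K q) : affineRep (P : ℙ K (Fin 3 → K)) 2 = 1 :=
  div_self (rep_two_ne_zero hq P)

theorem affineRep_curve (hq : q ≠ 0) (P : B K q) :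
    affineRep (P : ℙ K (Fin 3 → K)) 1 ^ q + affineRep (P : ℙ K (Fin 3 → K)) 1 =
      affineRep (P : ℙ K (Fin 3 → K)) 0 ^ (q + 1) := by
  have h2 := rep_two_ne_zero hq P
  have h : eval (P : ℙ K (Fin 3 → K)).rep (curve K q) = 0 := P.2.1
  rw [eval_curve] at h
  simp only [affineRep, div_pow]
  field_simp
  linear_combination (P : ℙ K (Fin 3 → K)).rep 2 ^ (q + 1) * h

theorem affineRep_injective (hq : q ≠ 0) :
    Function.Injective fun P : B K q => affineRep (P : ℙ K (Fin 3 → K)) := by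
  intro P Q h
  have hP := rep_two_ne_zero hq P
  have hQ := rep_two_ne_zero hq Q
  apply Subtype.ext
  rw [← (P : ℙ K (Fin 3 → K)).mk_rep, ← (Q : ℙ K (Fin 3 → K)).mk_rep,
    Projectivization.mk_eq_mk_iff']
  refine ⟨(P : ℙ K (Fin 3 → K)).rep 2 / (Q : ℙ K (Fin 3 → K)).rep 2, ?_⟩
  funext i
  have hi := congrFun h i
  simp only [affineRep] at hi
  simp only [Pi.smul_apply, smul_eq_mul]
  field_simp at hi ⊢
  linear_combination -hi

theorem exists_affineRep_eq {x y : K} (h : y ^ q + y = x ^ (q + 1)) :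
    ∃ P : B K q, affineRep (P : ℙ K (Fin 3 → K)) = ![x, y, 1] := by
  have hv : (![x, y, 1] : Fin 3 → K) ≠ 0 := fun h => one_ne_zero (congrFun h 2)
  obtain ⟨a, ha⟩ := Projectivization.exists_smul_eq_mk_rep K _ hv
  have hr : ∀ i, (Projectivization.mk K _ hv).rep i = (a : K) * (![x, y, 1] : Fin 3 → K) i := by
    intro i
    rw [← ha]
    rfl
  refine ⟨⟨Projectivization.mk K _ hv, ?_, ?_⟩, ?_⟩
  · change eval _ _ = _
    rw [eval_curve, hr, hr, hr]
    simp only [Matrix.cons_val]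
    linear_combination (a : K) ^ (q + 1) * h
  · rw [Set.mem_singleton_iff, Pinfty, Projectivization.mk_eq_mk_iff']
    rintro ⟨b, hb⟩
    simpa using congrFun hb 2
  · funext i
    simp only [affineRep, hr]
    have := a.ne_zero
    simp only [Matrix.cons_val]
    field_simp

theorem rep_mem_iff (L : Submodule K (Fin 3 → K)) (P : ℙ K (Fin 3 → K)) :
    P ∈ L.projectivization ↔ P.rep ∈ L := by
  conv_lhs => rw [← P.mk_rep]
  exact Submodule.mk_mem_projectivization_iff L P.rep_nonzero

theorem affineRep_mem_iff (hq : q ≠ 0) (L : Submodule K (Fin 3 → K)) (P : B K q) :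
    (P : ℙ K (Fin 3 → K)) ∈ L.projectivization ↔ affineRep (P : ℙ K (Fin 3 → K)) ∈ L := by
  have h : affineRep (P : ℙ K (Fin 3 → K)) =
      ((P : ℙ K (Fin 3 → K)).rep 2)⁻¹ • (P : ℙ K (Fin 3 → K)).rep := by
    funext i
    simp [affineRep, div_eq_inv_mul]
  rw [rep_mem_iff, h, L.smul_mem_iff (inv_ne_zero (rep_two_ne_zero hq P))]

/-- The lines through P_∞ that meet B are the vertical lines x = c: two affine points with different
x span the whole space together with P_∞. -/
theorem hasCollinear_iff (hq : q ≠ 0) {m : ℕ} (hm : 0 < m) (H : Set (B K q)) :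
    HasCollinear q m H ↔ ∃ c : K, ∃ S : Finset (B K q), S.card = m ∧
      ∀ P ∈ S, P ∉ H ∧ affineRep (P : ℙ K (Fin 3 → K)) 0 = c := by
  constructor
  · rintro ⟨L, hL, hinf, S, hS, hSL⟩
    obtain ⟨P₀, hP₀⟩ : S.Nonempty := Finset.card_pos.1 (by omega)
    refine ⟨affineRep (P₀ : ℙ K (Fin 3 → K)) 0, S, hS, fun P hP => ⟨(hSL P hP).1, ?_⟩⟩
    by_contra hne
    have h1 := (affineRep_mem_iff hq L P).1 (hSL P hP).2
    have h0 := (affineRep_mem_iff hq L P₀).1 (hSL P₀ hP₀).2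
    have he : (![0, 1, 0] : Fin 3 → K) ∈ L :=
      (Submodule.mk_mem_projectivization_iff L _).1 hinf
    set A := affineRep (P : ℙ K (Fin 3 → K)) with hA
    set A₀ := affineRep (P₀ : ℙ K (Fin 3 → K)) with hA₀
    have hA2 : A 2 = 1 := affineRep_two hq P
    have hA₀2 : A₀ 2 = 1 := affineRep_two hq P₀
    have hd : A 0 - A₀ 0 ≠ 0 := sub_ne_zero.2 hne
    have htop : L = ⊤ := by
      rw [eq_top_iff]
      intro v _
      -- The first two coefficients are forced by coordinates 0 and 2; the multiple of (0, 1, 0)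
      -- then corrects coordinate 1.
      have hv : v = ((v 0 - v 2 * A₀ 0) / (A 0 - A₀ 0)) • A +
          (v 2 - (v 0 - v 2 * A₀ 0) / (A 0 - A₀ 0)) • A₀ +
          (v 1 - (v 0 - v 2 * A₀ 0) / (A 0 - A₀ 0) * A 1 -
            (v 2 - (v 0 - v 2 * A₀ 0) / (A 0 - A₀ 0)) * A₀ 1) • ![0, 1, 0] := by
        funext i
        fin_cases i
        · simp
          field_simp
          ring
        · simp
        · simp [hA2, hA₀2]
      rw [hv]
      exact L.add_mem (L.add_mem (L.smul_mem _ h1) (L.smul_mem _ h0)) (L.smul_mem _ he)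
    rw [htop, finrank_top] at hL
    simp at hL
  · rintro ⟨c, S, hS, hSc⟩
    have hli : LinearIndependent K ![(![0, 1, 0] : Fin 3 → K), ![c, 0, 1]] := by
      rw [LinearIndependent.pair_iff]
      intro s t hst
      have h1 := congrFun hst 1
      have h2 := congrFun hst 2
      simp at h1 h2
      exact ⟨h1, h2⟩
    refine ⟨Submodule.span K (Set.range ![(![0, 1, 0] : Fin 3 → K), ![c, 0, 1]]), ?_, ?_, S, hS, ?_⟩
    · simpa using finrank_span_eq_card hli
    · exact (Submodule.mk_mem_projectivization_iff _ _).2 (Submodule.subset_span ⟨0, rfl⟩)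
    · intro P hP
      refine ⟨(hSc P hP).1, (affineRep_mem_iff hq _ P).2 ?_⟩
      have : affineRep (P : ℙ K (Fin 3 → K)) =
          affineRep (P : ℙ K (Fin 3 → K)) 1 • ![0, 1, 0] + (1 : K) • ![c, 0, 1] := by
        funext i
        fin_cases i
        · simp [(hSc P hP).2]
        · simp
        · simp [affineRep_two hq P]
      rw [this]
      exact Submodule.add_mem _ (Submodule.smul_mem _ _ (Submodule.subset_span ⟨0, rfl⟩))
        (Submodule.smul_mem _ _ (Submodule.subset_span ⟨1, rfl⟩))

end Points

/-! ### Forms vanishing on aP_∞: separating points, and restriction to vertical lines -/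

section Forms

variable {K : Type*} [Field K] {q d a : ℕ}

theorem mem_forms {f : MvPolynomial (Fin 3) K} :
    f ∈ forms K q d a ↔ f.IsHomogeneous d ∧ chart K f ∈ idealE K q a := Iff.rfl

/-- The line z = 0 is tangent at P_∞: on the curve z = x^(q+1) - z^q, which lies in the q-th power
of the maximal ideal. One factor z therefore supplies all the required vanishing. -/
theorem X_one_mem_idealE (haq : a ≤ q) : (X 1 : MvPolynomial (Fin 2) K) ∈ idealE K q a := by
  set m : Ideal (MvPolynomial (Fin 2) K) := Ideal.span {X 0, X 1}
  have h : (X 1 : MvPolynomial (Fin 2) K) =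
      chart K (curve K q) + (X 0 ^ (q + 1) - X 1 ^ q) := by
    simp [chart, curve]
  have hx : (X 0 : MvPolynomial (Fin 2) K) ∈ m := Ideal.subset_span (by simp)
  have hz : (X 1 : MvPolynomial (Fin 2) K) ∈ m := Ideal.subset_span (by simp)
  rw [h]
  refine Ideal.add_mem _ (Ideal.mem_sup_left (Ideal.subset_span rfl)) (Ideal.mem_sup_right ?_)
  exact Ideal.sub_mem _ (Ideal.pow_le_pow_right (by omega) (Ideal.pow_mem_pow hx _))
    (Ideal.pow_le_pow_right haq (Ideal.pow_mem_pow hz _))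

theorem mul_X_two_pow_mem_forms (haq : a ≤ q) {m k : ℕ} {g : MvPolynomial (Fin 3) K}
    (hg : g.IsHomogeneous m) (hk : k ≠ 0) (hd : m + k = d) : g * X 2 ^ k ∈ forms K q d a := by
  refine mem_forms.2 ⟨hd ▸ hg.mul (isHomogeneous_X_pow _ _), ?_⟩
  have : chart K (g * X 2 ^ k) = chart K g * X 1 ^ k := by simp [chart]
  rw [this]
  exact Ideal.mul_mem_left _ _ (Ideal.pow_mem_of_mem _ (X_one_mem_idealE haq) _ (by omega))

/-- The linear form `αx + βy + γz`. -/
noncomputable def linForm (α β γ : K) : MvPolynomial (Fin 3) K := C α * X 0 + C β * X 1 + C γ * X 2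

theorem isHomogeneous_linForm (α β γ : K) : (linForm α β γ).IsHomogeneous 1 :=
  ((isHomogeneous_C_mul_X α 0).add (isHomogeneous_C_mul_X β 1)).add (isHomogeneous_C_mul_X γ 2)

@[simp]
theorem eval_linForm (α β γ : K) (v : Fin 3 → K) :
    eval v (linForm α β γ) = α * v 0 + β * v 1 + γ * v 2 := by
  simp [linForm]

/-- Every vertical line passes through P_∞, so d of them vanish there to order at least d ≥ a. -/
theorem prod_vertical_mem_forms {ι : Type*} (T : Finset ι) (c : ι → K) (hT : T.card = d)
    (had : a ≤ d) : ∏ j ∈ T, linForm 1 0 (-c j) ∈ forms K q d a := by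
  refine mem_forms.2 ⟨?_, ?_⟩
  · have := IsHomogeneous.prod T (fun j => linForm 1 0 (-c j)) (fun _ => 1)
      fun j _ => isHomogeneous_linForm _ _ _
    simpa [hT] using this
  · rw [map_prod]
    refine Ideal.mem_sup_right (Ideal.pow_le_pow_right had ?_)
    rw [← hT, ← Finset.prod_const]
    refine Ideal.prod_mem_prod fun j _ => ?_
    simp only [linForm, chart, map_add, map_mul, aeval_X, algHom_C]
    refine Ideal.add_mem _ (Ideal.add_mem _ ?_ ?_) ?_
    · exact Ideal.mul_mem_left _ _ (Ideal.subset_span (by simp))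
    · simp
    · exact Ideal.mul_mem_left _ _ (Ideal.subset_span (by simp))

theorem exists_linForm_separating {u w : Fin 3 → K} (hu : u 2 = 1) (hw : w 2 = 1) (h : u ≠ w) :
    ∃ g : MvPolynomial (Fin 3) K, g.IsHomogeneous 1 ∧ eval u g = 0 ∧ eval w g ≠ 0 := by
  by_cases h0 : u 0 = w 0
  · refine ⟨linForm 0 1 (-u 1), isHomogeneous_linForm _ _ _, by simp [hu], ?_⟩
    intro hz
    apply h
    simp only [eval_linForm, hw] at hz
    funext i
    fin_cases i
    · exact h0
    · change u 1 = w 1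
      linear_combination -hz
    · exact hu.trans hw.symm
  · refine ⟨linForm 1 0 (-u 0), isHomogeneous_linForm _ _ _, by simp [hu], ?_⟩
    intro hz
    apply h0
    simp only [eval_linForm, hw] at hz
    linear_combination -hz

theorem exists_form_separating {ι : Type*} (A : ι → Fin 3 → K) (hA : ∀ j, A j 2 = 1)
    (hinj : Function.Injective A) (T : Finset ι) (i : ι) (hi : i ∉ T) :
    ∃ g : MvPolynomial (Fin 3) K, g.IsHomogeneous T.card ∧ (∀ j ∈ T, eval (A j) g = 0) ∧
      eval (A i) g ≠ 0 := by
  have h : ∀ j : ι, ∃ g : MvPolynomial (Fin 3) K, j ≠ i →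
      g.IsHomogeneous 1 ∧ eval (A j) g = 0 ∧ eval (A i) g ≠ 0 := by
    intro j
    by_cases hj : j = i
    · exact ⟨0, fun h => absurd hj h⟩
    · obtain ⟨g, hg⟩ := exists_linForm_separating (hA j) (hA i) (hinj.ne hj)
      exact ⟨g, fun _ => hg⟩
  choose g hg using h
  have hne : ∀ j ∈ T, j ≠ i := fun j hj hji => hi (hji ▸ hj)
  refine ⟨∏ j ∈ T, g j, ?_, ?_, ?_⟩
  · simpa using IsHomogeneous.prod T g (fun _ => 1) fun j hj => (hg j (hne j hj)).1
  · intro j hj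
    rw [map_prod]
    exact Finset.prod_eq_zero hj (hg j (hne j hj)).2.1
  · rw [map_prod, Finset.prod_ne_zero_iff]
    exact fun j hj => (hg j (hne j hj)).2.2

theorem exists_mem_forms_separating {ι : Type*} (A : ι → Fin 3 → K)
    (hA : ∀ j, A j 2 = 1) (hinj : Function.Injective A) (haq : a ≤ q) (had : a ≤ d) (S : Finset ι)
    (i : ι) (hi : i ∈ S) (hS : S.card ≤ d + 1)
    (hvert : ¬(S.card = d + 1 ∧ ∀ j ∈ S, A j 0 = A i 0)) :
    ∃ f ∈ forms K q d a, (∀ j ∈ S, j ≠ i → eval (A j) f = 0) ∧ eval (A i) f ≠ 0 := by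
  classical
  have hcard := Finset.card_erase_of_mem hi
  have hpos : 0 < S.card := Finset.card_pos.2 ⟨i, hi⟩
  -- With at most d points, the other points need at most d - 1 lines, leaving room for a factor z.
  by_cases hlt : S.card ≤ d
  · obtain ⟨g, hg, hg0, hgi⟩ :=
      exists_form_separating A hA hinj (S.erase i) i (Finset.notMem_erase i S)
    refine ⟨g * X 2 ^ (d - (S.erase i).card),
      mul_X_two_pow_mem_forms haq hg (by omega) (by omega), ?_, ?_⟩
    · intro j hj hji
      simp [hg0 j (Finset.mem_erase.2 ⟨hji, hj⟩)]
    · simpa [hA i] using hgi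
  have hd : S.card = d + 1 := by omega
  -- With d + 1 points and none of the others on the vertical line of i, the d vertical lines
  -- through the others suffice.
  by_cases hx : ∀ j ∈ S.erase i, A j 0 ≠ A i 0
  · refine ⟨∏ j ∈ S.erase i, linForm 1 0 (-A j 0),
      prod_vertical_mem_forms _ _ (by omega) had, ?_, ?_⟩
    · intro j hj hji
      rw [map_prod]
      exact Finset.prod_eq_zero (Finset.mem_erase.2 ⟨hji, hj⟩) (by simp [hA j])
    · rw [map_prod, Finset.prod_ne_zero_iff]
      intro j hj hz
      apply hx j hj
      simp only [eval_linForm, hA i] at hz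
      linear_combination -hz
  · push Not at hx
    obtain ⟨k, hk, hki⟩ := hx
    obtain ⟨l, hl, hli⟩ : ∃ l ∈ S, A l 0 ≠ A i 0 := by
      by_contra hcon
      push Not at hcon
      exact hvert ⟨hd, hcon⟩
    have hle : l ∈ (S.erase i).erase k := by
      refine Finset.mem_erase.2 ⟨?_, Finset.mem_erase.2 ⟨?_, hl⟩⟩
      · rintro rfl
        exact hli hki
      · rintro rfl
        exact hli rfl
    -- Here k shares the vertical line of i and l does not, so the line through k and l misses i. It
    -- handles two points at once; with d - 2 lines for T, one degree remains for the factor z.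
    set T := ((S.erase i).erase k).erase l with hT
    have hTc := Finset.card_erase_of_mem hle
    have hTc' := Finset.card_erase_of_mem hk
    rw [← hT] at hTc
    have hT' : 0 < ((S.erase i).erase k).card := Finset.card_pos.2 ⟨l, hle⟩
    obtain ⟨g, hg, hg0, hgi⟩ := exists_form_separating A hA hinj T i (by simp [hT])
    have hline := isHomogeneous_linForm (A l 1 - A k 1) (-(A l 0 - A k 0))
      (-((A l 1 - A k 1) * A k 0 - (A l 0 - A k 0) * A k 1))
    refine ⟨_, mul_X_two_pow_mem_forms (k := 1) haq (hg.mul hline) one_ne_zero (by omega), ?_, ?_⟩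
    · intro j hj hji
      by_cases hjk : j = k
      · subst hjk
        simp only [map_mul, eval_linForm, hA]
        ring
      by_cases hjl : j = l
      · subst hjl
        simp only [map_mul, eval_linForm, hA]
        ring
      · simp [hg0 j (by simp [hT, hjl, hjk, hji, hj])]
    · simp only [map_mul, map_pow, eval_X, hA, one_pow, mul_one, eval_linForm]
      refine mul_ne_zero hgi ?_
      have hy : A k 1 ≠ A i 1 := by
        intro hy
        refine (Finset.mem_erase.1 hk).1 (hinj (funext fun s => ?_))
        fin_cases s
        · exact hki
        · exact hy
        · exact (hA k).trans (hA i).symm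
      have hne := mul_ne_zero (sub_ne_zero.2 hli) (sub_ne_zero.2 hy)
      intro hz
      apply hne
      rw [hki] at hz
      linear_combination hz

theorem eval_Pinfty_of_mem_forms (ha : 1 ≤ a) (hq : q ≠ 0) {f : MvPolynomial (Fin 3) K}
    (hf : f ∈ forms K q d a) : eval ![0, 1, 0] f = 0 := by
  have hle : idealE K q a ≤ RingHom.ker (eval (0 : Fin 2 → K)) := by
    refine sup_le ?_ ((Ideal.pow_le_self (by omega)).trans ?_)
    · rw [Ideal.span_le, Set.singleton_subset_iff]
      simp [RingHom.mem_ker, chart, curve, hq]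
    · rw [Ideal.span_le]
      rintro _ (rfl | rfl) <;> simp [RingHom.mem_ker]
  have h : eval (0 : Fin 2 → K) (chart K f) = eval ![0, 1, 0] f := by
    have : ((aeval (0 : Fin 2 → K) : _ →ₐ[K] K).comp (chart K)) = aeval ![0, 1, 0] := by
      ext i
      fin_cases i <;> simp [chart]
    exact congrArg (fun φ : MvPolynomial (Fin 3) K →ₐ[K] K => φ f) this
  rw [← h]
  exact hle hf.2

/-- The only monomial of degree d in y is y^d, and its coefficient is the value of f at P_∞, which
is zero. -/
theorem degree_aeval_vertical_lt (ha : 1 ≤ a) (hq : q ≠ 0) (c : K) {f : MvPolynomial (Fin 3) K}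
    (hf : f ∈ forms K q d a) :
    (aeval ![Polynomial.C c, Polynomial.X, 1] f : Polynomial K).degree < d := by
  have hhom : f.IsHomogeneous d := hf.1
  have key : ∀ s : Fin 3 →₀ ℕ, f.coeff s ≠ 0 → s 0 + s 1 + s 2 = d := by
    intro s hs
    have := hhom hs
    rw [Finsupp.weight_apply, Finsupp.sum_fintype _ _ (by simp)] at this
    simpa [Fin.sum_univ_three] using this
  have h0 : f.coeff (Finsupp.single 1 d) = 0 := by
    have h := eval_Pinfty_of_mem_forms ha hq hf
    rw [eval_eq'] at h
    rw [← h]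
    symm
    rw [Finset.sum_eq_single (Finsupp.single 1 d)]
    · simp [Fin.prod_univ_three]
    · intro s hs hne
      have hs' := key s (mem_support_iff.1 hs)
      have : s 0 ≠ 0 ∨ s 2 ≠ 0 := by
        by_contra hcon
        push Not at hcon
        apply hne
        ext i
        fin_cases i <;> simp <;> omega
      rcases this with h | h <;> simp [Fin.prod_univ_three, h]
    · intro hs
      simp [notMem_support_iff.1 hs]
  rw [aeval_eq_eval₂Hom, coe_eval₂Hom, eval₂_eq']
  refine lt_of_le_of_lt (Polynomial.degree_sum_le _ _)
    ((Finset.sup_lt_iff (WithBot.bot_lt_coe d)).2 fun s hs => ?_)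
  have hs' := mem_support_iff.1 hs
  have hsd := key s hs'
  have hlt : s 1 < d := by
    by_contra hcon
    apply hs'
    rw [← h0]
    congr 1
    ext i
    fin_cases i <;> simp <;> omega
  have : (algebraMap K (Polynomial K) (f.coeff s) *
      ∏ i, (![Polynomial.C c, Polynomial.X, 1] : Fin 3 → Polynomial K) i ^ s i) =
      Polynomial.C (f.coeff s * c ^ s 0) * Polynomial.X ^ s 1 := by
    simp [Fin.prod_univ_three, Polynomial.algebraMap_eq, mul_assoc]
  rw [this]
  exact lt_of_le_of_lt (Polynomial.degree_C_mul_X_pow_le _ _) (Nat.cast_lt.2 hlt)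

end Forms

/-! ### Dual words of weight at most d + 1 -/

section Codes

variable {K : Type*} [Field K] {q d a : ℕ} {ι : Type*}

/-- The code obtained evaluating the forms at an arbitrary family of points of `B`. -/
noncomputable def evalCode (q d a : ℕ) (pt : ι → B K q) : Submodule K (ι → K) :=
  (forms K q d a).map (evalAt fun i => (pt i : ℙ K (Fin 3 → K)))

theorem map_proj_code (H : Set (B K q)) :
    (code K q d a).map (LinCode.proj K H) =
      evalCode q d a (Subtype.val : {P : B K q // P ∉ H} → B K q) := by
  rw [code, ← Submodule.map_comp]
  rfl

theorem mem_dual_evalCode_iff [Fintype ι] {pt : ι → B K q} {v : ι → K} :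
    v ∈ LinCode.dual (evalCode q d a pt) ↔ ∀ f ∈ forms K q d a,
      ∑ i, v i * eval (affineRep (pt i : ℙ K (Fin 3 → K))) f = 0 := by
  constructor
  · intro h f hf
    exact h _ ⟨f, hf, rfl⟩
  · rintro h _ ⟨f, hf, rfl⟩
    exact h f hf

open Classical in
theorem dual_evalCode_support [Fintype ι] {pt : ι → B K q} (hpt : Function.Injective pt)
    (hq : q ≠ 0) (haq : a ≤ q) (had : a ≤ d) {v : ι → K}
    (hv : v ∈ LinCode.dual (evalCode q d a pt)) (h0 : v ≠ 0) (hle : hammingNorm v ≤ d + 1) :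
    hammingNorm v = d + 1 ∧ ∃ c : K, ∃ S : Finset ι, S.card = d + 1 ∧
      ∀ j ∈ S, affineRep (pt j : ℙ K (Fin 3 → K)) 0 = c := by
  obtain ⟨i, hi⟩ := Function.ne_iff.1 h0
  set S : Finset ι := {j | v j ≠ 0} with hS
  have hSn : S.card = hammingNorm v := rfl
  by_contra hcon
  obtain ⟨f, hf, hfz, hfi⟩ := exists_mem_forms_separating
    (fun j => affineRep (pt j : ℙ K (Fin 3 → K))) (fun j => affineRep_two hq (pt j))
    ((affineRep_injective hq).comp hpt) haq had S i (by simpa [hS] using hi) (by omega)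
    fun h => hcon ⟨by omega, _, S, h.1, h.2⟩
  have hsum := mem_dual_evalCode_iff.1 hv f hf
  rw [Finset.sum_eq_single i] at hsum
  · exact mul_ne_zero hi hfi hsum
  · intro j _ hji
    by_cases hj : v j = 0
    · simp [hj]
    · rw [hfz j (by simpa [hS] using hj) hji, mul_zero]
  · simp

open Classical in
theorem exists_mem_dual_evalCode [Fintype ι] {pt : ι → B K q} (hpt : Function.Injective pt)
    (hq : q ≠ 0) (ha : 1 ≤ a) {c : K} {S : Finset ι} (hS : S.card = d + 1)
    (hSc : ∀ j ∈ S, affineRep (pt j : ℙ K (Fin 3 → K)) 0 = c) :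
    ∃ v ∈ LinCode.dual (evalCode q d a pt), v ≠ 0 ∧ hammingNorm v ≤ d + 1 := by
  set y : ι → K := fun j => affineRep (pt j : ℙ K (Fin 3 → K)) 1 with hy
  have hA : ∀ j ∈ S, affineRep (pt j : ℙ K (Fin 3 → K)) = ![c, y j, 1] := by
    intro j hj
    funext s
    fin_cases s
    · exact hSc j hj
    · rfl
    · exact affineRep_two hq (pt j)
  have hinj : Set.InjOn y S := by
    intro j hj k hk hjk
    apply hpt
    apply affineRep_injective hq
    change affineRep (pt j : ℙ K (Fin 3 → K)) = affineRep (pt k : ℙ K (Fin 3 → K))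
    rw [hA j hj, hA k hk, hjk]
  -- Lagrange weights: on d + 1 nodes their pairing with p is the coefficient of degree d of p, zero
  -- because p has degree below d.
  refine ⟨fun j => if j ∈ S then (∏ k ∈ S.erase j, (y j - y k))⁻¹ else 0, ?_, ?_, ?_⟩
  · refine mem_dual_evalCode_iff.2 fun f hf => ?_
    have hdeg := degree_aeval_vertical_lt ha hq c hf
    set p : Polynomial K := aeval ![Polynomial.C c, Polynomial.X, 1] f with hp
    have heval : ∀ j ∈ S, eval (affineRep (pt j : ℙ K (Fin 3 → K))) f = p.eval (y j) := by
      intro j hj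
      rw [hA j hj, hp]
      have : (Polynomial.aeval (y j)).comp
          (aeval ![Polynomial.C c, Polynomial.X, 1] : _ →ₐ[K] Polynomial K) =
          aeval ![c, y j, 1] := by
        ext s
        fin_cases s <;> simp
      have := congrArg (fun φ : MvPolynomial (Fin 3) K →ₐ[K] K => φ f) this
      simpa [Polynomial.aeval_def, ← Polynomial.eval₂_id] using this.symm
    have hcoeff := Lagrange.coeff_eq_sum hinj (P := p)
      (hdeg.trans (by rw [hS]; exact_mod_cast Nat.lt_succ_self d))
    rw [hS, Nat.add_sub_cancel, Polynomial.coeff_eq_zero_of_degree_lt hdeg] at hcoeff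
    refine Eq.trans ?_ hcoeff.symm
    rw [← Finset.sum_subset (Finset.subset_univ S)]
    · refine Finset.sum_congr rfl fun j hj => ?_
      rw [if_pos hj, heval j hj, div_eq_inv_mul]
    · intro j _ hj
      rw [if_neg hj, zero_mul]
  · obtain ⟨j, hj⟩ : S.Nonempty := Finset.card_pos.1 (by omega)
    refine Function.ne_iff.2 ⟨j, ?_⟩
    simp only [if_pos hj, Pi.zero_apply]
    refine inv_ne_zero (Finset.prod_ne_zero_iff.2 fun k hk => sub_ne_zero.2 fun h => ?_)
    exact (Finset.mem_erase.1 hk).1 (hinj hj (Finset.mem_erase.1 hk).2 h).symm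
  · rw [← hS]
    refine Finset.card_le_card fun j hj => ?_
    by_contra hjS
    simp [hjS] at hj

theorem le_minDist_dual_evalCode [Fintype ι] {pt : ι → B K q} (hpt : Function.Injective pt)
    (hq : q ≠ 0) (haq : a ≤ q) (had : a ≤ d) :
    ((d + 1 : ℕ) : ℕ∞) ≤ LinCode.minDist (LinCode.dual (evalCode q d a pt)) := by
  refine LinCode.le_minDist_iff.2 fun v hv h0 => ?_
  rw [Nat.cast_le]
  by_contra hlt
  have := (dual_evalCode_support hpt hq haq had hv h0 (by omega)).1
  omega

theorem minDist_dual_evalCode_le_iff [Fintype ι] {pt : ι → B K q} (hpt : Function.Injective pt)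
    (hq : q ≠ 0) (ha : 1 ≤ a) (haq : a ≤ q) (had : a ≤ d) :
    LinCode.minDist (LinCode.dual (evalCode q d a pt)) ≤ ((d + 1 : ℕ) : ℕ∞) ↔
      ∃ c : K, ∃ S : Finset ι, S.card = d + 1 ∧
        ∀ j ∈ S, affineRep (pt j : ℙ K (Fin 3 → K)) 0 = c := by
  classical
  constructor
  · intro h
    by_contra hcon
    have : ((d + 2 : ℕ) : ℕ∞) ≤ LinCode.minDist (LinCode.dual (evalCode q d a pt)) := by
      refine LinCode.le_minDist_iff.2 fun v hv h0 => ?_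
      rw [Nat.cast_le]
      by_contra hlt
      exact hcon (dual_evalCode_support hpt hq haq had hv h0 (by omega)).2
    have := Nat.cast_le.1 (this.trans h)
    omega
  · rintro ⟨c, S, hS, hSc⟩
    obtain ⟨v, hv, h0, hle⟩ := exists_mem_dual_evalCode (d := d) hpt hq ha hS hSc
    exact (LinCode.minDist_le_hammingNorm hv h0).trans (Nat.cast_le.2 (by convert hle))

end Codes

/-! ### Counting points of B on vertical lines -/

section Counting

open Finset

variable {K : Type*} [Field K] [Fintype K] {q : ℕ}

theorem add_pow_of_card_eq_sq (hq : IsPrimePow q) (hK : Fintype.card K = q ^ 2) (x y : K) :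
    (x + y) ^ q = x ^ q + y ^ q := by
  obtain ⟨p, n, hp, hn, rfl⟩ := hq
  have hp' : p.Prime := hp.nat_prime
  have : Fact p.Prime := ⟨hp'⟩
  have : CharP K p := by
    obtain ⟨r, hr⟩ := CharP.exists K
    obtain ⟨m, hrp, hm⟩ := FiniteField.card K r
    have hpr : p = r := by
      have h1 : p ∣ r ^ (m : ℕ) := by
        rw [← hm, hK, ← pow_mul]
        exact dvd_pow_self p (by positivity)
      exact (Nat.prime_dvd_prime_iff_eq hp' hrp).1 (hp'.dvd_of_dvd_pow h1)
    exact hpr ▸ hr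
  exact add_pow_char_pow x y p n

open Classical in
-- The map y ↦ y^q + y takes at most q values, the roots of t^q = t, and each fibre has at most q
-- elements as a root set of a degree q polynomial. Since K has q² elements, every bound is
-- attained.
theorem card_trace_fiber (hq : IsPrimePow q) (hK : Fintype.card K = q ^ 2) {t : K}
    (ht : t ^ q = t) : #{y : K | y ^ q + y = t} = q := by
  have hq1 : 1 < q := hq.one_lt
  have hadd := add_pow_of_card_eq_sq hq hK
  have hfrob : ∀ x : K, (x ^ q) ^ q = x := fun x => by
    rw [← pow_mul, ← sq, ← hK, FiniteField.pow_card]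
  have hdegX : (Polynomial.X : Polynomial K).degree < (q : WithBot ℕ) := by
    rw [Polynomial.degree_X]; exact_mod_cast hq1
  have hker : ∀ s : K, #{y : K | y ^ q + y = s} ≤ q := by
    intro s
    have hlin : (Polynomial.X - Polynomial.C s).degree < (q : WithBot ℕ) := by
      rw [Polynomial.degree_X_sub_C]; exact_mod_cast hq1
    have hne : (Polynomial.X ^ q + (Polynomial.X - Polynomial.C s)) ≠ 0 :=
      (Polynomial.monic_X_pow_add hlin).ne_zero
    have hdeg : (Polynomial.X ^ q + (Polynomial.X - Polynomial.C s)).natDegree = q :=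
      Polynomial.natDegree_eq_of_degree_eq_some (by
        rw [Polynomial.degree_add_eq_left_of_degree_lt, Polynomial.degree_X_pow]
        rwa [Polynomial.degree_X_pow])
    refine (Polynomial.card_le_degree_of_subset_roots fun y hy => ?_).trans hdeg.le
    have hy' : y ^ q + y = s := by simpa using hy
    rw [Polynomial.mem_roots hne]
    simp [Polynomial.IsRoot, ← hy']
  have himg : #{t : K | t ^ q = t} ≤ q := by
    have hlin : (-Polynomial.X : Polynomial K).degree < (q : WithBot ℕ) := by rwa [Polynomial.degree_neg]
    have hne : (Polynomial.X ^ q + -Polynomial.X : Polynomial K) ≠ 0 :=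
      (Polynomial.monic_X_pow_add hlin).ne_zero
    have hdeg : (Polynomial.X ^ q + -Polynomial.X : Polynomial K).natDegree = q :=
      Polynomial.natDegree_eq_of_degree_eq_some (by
        rw [Polynomial.degree_add_eq_left_of_degree_lt, Polynomial.degree_X_pow]
        rwa [Polynomial.degree_X_pow])
    refine (Polynomial.card_le_degree_of_subset_roots fun y hy => ?_).trans hdeg.le
    have hy' : y ^ q = y := by simpa using hy
    rw [Polynomial.mem_roots hne]
    simp [Polynomial.IsRoot, hy']
  have hmaps : ∀ y ∈ (univ : Finset K), y ^ q + y ∈ ({t : K | t ^ q = t} : Finset K) := by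
    intro y _
    simp only [mem_filter, mem_univ, true_and]
    rw [hadd, hfrob, add_comm]
  have hsum := card_eq_sum_card_fiberwise hmaps
  rw [card_univ, hK] at hsum
  by_contra hne
  have hlt : #{y : K | y ^ q + y = t} < q := lt_of_le_of_ne (hker t) hne
  have : ∑ s ∈ ({t : K | t ^ q = t} : Finset K), #{y : K | y ^ q + y = s} <
      ∑ s ∈ ({t : K | t ^ q = t} : Finset K), q :=
    sum_lt_sum (fun s _ => hker s) ⟨t, by simpa using ht, hlt⟩
  rw [sum_const, smul_eq_mul] at this
  nlinarith

open Classical in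
theorem card_vertical (hq : IsPrimePow q) (hK : Fintype.card K = q ^ 2) (c : K) :
    #{P : B K q | affineRep (P : ℙ K (Fin 3 → K)) 0 = c} = q := by
  have ht : (c ^ (q + 1)) ^ q = c ^ (q + 1) := by
    have : (c ^ q) ^ q = c := by rw [← pow_mul, ← sq, ← hK, FiniteField.pow_card]
    calc (c ^ (q + 1)) ^ q = (c ^ q) ^ q * c ^ q := by ring
      _ = c ^ (q + 1) := by rw [this, pow_succ, mul_comm]
  refine Eq.trans ?_ (card_trace_fiber hq hK ht)
  refine card_bij (fun P _ => affineRep (P : ℙ K (Fin 3 → K)) 1) ?_ ?_ ?_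
  · intro P hP
    simp only [mem_filter, mem_univ, true_and] at hP ⊢
    rw [affineRep_curve hq.ne_zero, hP]
  · intro P hP Q hQ h
    simp only [mem_filter, mem_univ, true_and] at hP hQ
    apply affineRep_injective hq.ne_zero
    funext s
    fin_cases s
    · exact hP.trans hQ.symm
    · exact h
    · exact (affineRep_two hq.ne_zero P).trans (affineRep_two hq.ne_zero Q).symm
  · intro y hy
    simp only [mem_filter, mem_univ, true_and] at hy
    obtain ⟨P, hP⟩ := exists_affineRep_eq hy
    exact ⟨P, by simp [hP], by simp [hP]⟩

open Classical in
theorem card_B (hq : IsPrimePow q) (hK : Fintype.card K = q ^ 2) :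
    Fintype.card (B K q) = q ^ 2 * q := by
  rw [← card_univ, card_eq_sum_card_fiberwise
    (f := fun P : B K q => affineRep (P : ℙ K (Fin 3 → K)) 0) (t := univ) (fun _ _ => mem_univ _),
    sum_congr rfl fun c _ => card_vertical hq hK c, sum_const, card_univ, hK, smul_eq_mul]

theorem ncard_compl_le (hq : IsPrimePow q) (hK : Fintype.card K = q ^ 2) {d : ℕ}
    {H : Set (B K q)} (h : ¬HasCollinear q (d + 1) H) : Hᶜ.ncard ≤ q ^ 2 * d := by
  classical
  rw [Set.ncard_eq_toFinset_card', card_eq_sum_card_fiberwise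
    (f := fun P : B K q => affineRep (P : ℙ K (Fin 3 → K)) 0) (t := univ) (fun _ _ => mem_univ _)]
  refine (sum_le_card_nsmul _ _ d fun c _ => ?_).trans_eq (by rw [card_univ, hK, smul_eq_mul])
  by_contra hlt
  obtain ⟨S, hS, hSc⟩ := exists_subset_card_eq (Nat.succ_le_of_lt (not_le.1 hlt))
  refine h ((hasCollinear_iff hq.ne_zero d.succ_pos H).2 ⟨c, S, hSc, fun P hP => ?_⟩)
  simpa using hS hP

end Counting

theorem isImprovingSubset_iff {K : Type*} [Field K] [Fintype K] {q : ℕ} (hq : IsPrimePow q)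
    (hK : Fintype.card K = q ^ 2) {d a : ℕ} (hdq : d < q) (ha : 1 ≤ a) (had : a ≤ d)
    {H : Set (B K q)} (hH : H.Nonempty) :
    LinCode.IsImprovingSubset (code K q d a) H ↔ ¬HasCollinear q (d + 1) H := by
  classical
  have haq : a ≤ q := by omega
  have hcode : code K q d a = evalCode q d a (id : B K q → B K q) := rfl
  have hmin : LinCode.minDist (LinCode.dual (code K q d a)) = ((d + 1 : ℕ) : ℕ∞) := by
    rw [hcode]
    refine le_antisymm ?_ (le_minDist_dual_evalCode Function.injective_id hq.ne_zero haq had)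
    -- Any vertical line would do: x = 0 already carries q ≥ d + 1 points of B.
    refine (minDist_dual_evalCode_le_iff Function.injective_id hq.ne_zero ha haq had).2 ⟨0, ?_⟩
    obtain ⟨S, hS, hSc⟩ := Finset.exists_subset_card_eq
      (Nat.succ_le_of_lt (hdq.trans_eq (card_vertical hq hK (0 : K)).symm))
    exact ⟨S, hSc, fun P hP => by simpa using hS hP⟩
  rw [LinCode.IsImprovingSubset, hmin, map_proj_code, and_iff_right hH, ← not_le, not_iff_not,
    minDist_dual_evalCode_le_iff Subtype.val_injective hq.ne_zero ha haq had,
    hasCollinear_iff hq.ne_zero d.succ_pos]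
  refine exists_congr fun c => ⟨?_, ?_⟩
  · rintro ⟨S, hS, hSc⟩
    refine ⟨S.map (Function.Embedding.subtype _), by rw [Finset.card_map, hS], fun P hP => ?_⟩
    obtain ⟨Q, hQ, rfl⟩ := Finset.mem_map.1 hP
    exact ⟨Q.2, hSc Q hQ⟩
  · rintro ⟨S, hS, hSc⟩
    refine ⟨S.subtype (· ∉ H), ?_, fun P hP => (hSc P (Finset.mem_subtype.1 hP)).2⟩
    rw [Finset.card_subtype, Finset.filter_true_of_mem fun P hP => (hSc P hP).1, hS]

end Hermitian

theorem corollary6p5 {K : Type*} [Field K] [Fintype K] (q : ℕ) (hq : IsPrimePow q)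
    (hK : Fintype.card K = q ^ 2) (d a : ℕ) (hd : 0 < d) (hdq : d < q) (ha : 1 ≤ a) (had : a ≤ d)
    (H : Set (Hermitian.B K q)) [DecidablePred (· ∈ H)] (hH : H.Nonempty) :
    (LinCode.IsImprovingSubset (Hermitian.code K q d a) H ↔
      ¬ Hermitian.HasCollinear q (d + 1) H) ∧
    (LinCode.IsImprovingSubset (Hermitian.code K q d a) H →
      q ^ 2 * (q - d) ≤ H.ncard ∧
      LinCode.length (LinCode.dual (Hermitian.codeH q d a H)) ≤ q ^ 2 * d) := by
  have hiff := Hermitian.isImprovingSubset_iff hq hK hdq ha had hH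
  refine ⟨hiff, fun himp => ?_⟩
  have hle := Hermitian.ncard_compl_le hq hK (hiff.1 himp)
  have hB := Set.ncard_add_ncard_compl H
  rw [Nat.card_eq_fintype_card, Hermitian.card_B hq hK] at hB
  refine ⟨?_, ?_⟩
  · rw [Nat.mul_sub]
    omega
  · exact (Nat.card_coe_set_eq Hᶜ).trans_le hle
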